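/- Let $\mathbb R^{1,2}$ be $\mathbb R^3$ with the quadratic form $Q(x)=-x_0^2+x_1^2+x_2^2$. Let $O^0(1,2)$ be the identity component of $O(1,2)=O(Q)$, acting linearly on two-dimensional de Sitter space $dS^2=\{x\in\mathbb R^{1,2}: Q(x)=1\}$. Let $G\cong\widetilde O^0(1,2)$ be the universal covering group of $O^0(1,2)$, let $\widetilde{dS}^2$ be the universal covering space of $dS^2$, and let $G$ act on $\widetilde{dS}^2$ by the continuous action lifting the action of $O^0(1,2)$ on $dS^2$. Let $H$ be a connected Lie group, and let $G\times H$ act on $\widetilde{dS}^2\times H$ by $(g,h)\cdot(x,y)=(gx,hy)$. Then there is no subgroup $\Gamma\subseteq G\times H$ that acts properly discontinuously and cocompactly on $\widetilde{dS}^2\times H$. Here $\Gamma$ acts properly discontinuously on $Y$ if $\{\gamma\in\Gamma:\gamma A\cap B\neq\emptyset\}$ is finite for all compact $A,B\subseteq Y$, and cocompactly if the quotient space $\Gamma\backslash Y$ is compact. -/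

import Mathlib

open scoped Manifold ContDiff Matrix

/-- The quadratic form of signature `(1,2)` on `ℝ³` (Minkowski space `ℝ^{1,2}`). -/
def minkowskiQ (x : Fin 3 → ℝ) : ℝ := -(x 0) ^ 2 + (x 1) ^ 2 + (x 2) ^ 2

/-- The Lorentz group `O(1,2)`, with the topology it inherits from `GL₃(ℝ)`. -/
def O12 : Subgroup (GL (Fin 3) ℝ) where
  carrier := {A | ∀ x : Fin 3 → ℝ, minkowskiQ (A.val *ᵥ x) = minkowskiQ x}
  one_mem' := by intro x; simp
  mul_mem' := by
    intro A B hA hB x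
    rw [Units.val_mul, ← Matrix.mulVec_mulVec, hA, hB]
  inv_mem' := by
    intro A hA x
    rw [← hA ((A⁻¹).val *ᵥ x), Matrix.mulVec_mulVec, ← Units.val_mul, mul_inv_cancel,
      Units.val_one, Matrix.one_mulVec]

/-- `O⁰(1,2)`, the identity component of `O(1,2)`, as a topological group. -/
abbrev O12Zero : Type := Subgroup.connectedComponentOfOne O12

/-- Two-dimensional de Sitter space `dS²`, the one-sheeted hyperboloid `Q = 1` in `ℝ^{1,2}`. -/
abbrev DeSitter2 : Type := {x : Fin 3 → ℝ // minkowskiQ x = 1}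

/-- The isometric action of `O⁰(1,2)` on `dS²`, by linear maps. -/
instance deSitterAction : MulAction O12Zero DeSitter2 where
  smul g x := ⟨(g : O12).val.val *ᵥ x.val, by rw [(g : O12).property x.val, x.property]⟩
  one_smul x := Subtype.ext (Matrix.one_mulVec x.val)
  mul_smul g h x := Subtype.ext
    (Matrix.mulVec_mulVec x.val (g : O12).val.val (h : O12).val.val).symm

/-- `p : E → X` is a universal covering: a surjective covering map with simply connected total
space. -/
structure IsUniversalCovering {E X : Type*} [TopologicalSpace E] [TopologicalSpace X]
    (p : E → X) : Prop where
  simplyConnected : SimplyConnectedSpace E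
  isCoveringMap : IsCoveringMap p
  surjective : Function.Surjective p

/-- The action of `G × H` on `D × H` in which `G` acts on `D` in the given way and `H` acts on
itself by left translation: `(g, h) • (x, y) = (g • x, h * y)`. -/
instance prodTranslationAction {G D H : Type*} [Group G] [MulAction G D] [Group H] :
    MulAction (G × H) (D × H) where
  smul γ y := (γ.1 • y.1, γ.2 * y.2)
  one_smul y := Prod.ext (one_smul G y.1) (one_mul y.2)
  mul_smul γ δ y := Prod.ext (mul_smul γ.1 δ.1 y.1) (mul_assoc γ.2 δ.2 y.2)

/-- The action of `Γ` (regarded as a discrete group) on `Y` is properly discontinuous: it is a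
proper action, that is, `{γ | γ A ∩ B ≠ ∅}` is compact (finite, `Γ` being discrete) for all
compact `A, B ⊆ Y`. -/
abbrev ActsProperlyDiscontinuously (Γ Y : Type*) [Group Γ] [TopologicalSpace Y]
    [MulAction Γ Y] : Prop :=
  ProperlyDiscontinuousSMul Γ Y

/-- The action of `Γ` on `Y` is cocompact: the quotient space `Γ \ Y` is compact. -/
abbrev ActsCocompactly (Γ Y : Type*) [Group Γ] [TopologicalSpace Y] [MulAction Γ Y] : Prop :=
  CompactSpace (MulAction.orbitRel.Quotient Γ Y)

/-!
The covering group `G` acts transitively on `D`, the universal cover of `dS²`, and the stabilizer of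
a point is a one-parameter group `a` of boosts (`IsUniversalCovering.exists_decomposition`). Here
simple connectedness of `D` enters: an orthonormal frame on `dS²` lifts to a map `D → G`. So if `Γ`
acted properly discontinuously and cocompactly on `D × H`, then `Γ × ℤ` would act properly and
cocompactly on the locally compact group `K = G × H` by `(γ, n) • x = γ x aⁿ`, where `a` now is the
boost with parameter `1`.

That is impossible. Averaging a bump function gives a continuous `Γ`-invariant height `f : K → ℝ`
with `f (x a) = f x + 1` (`exists_equivariant_height`), bounded only on sets that are compact modulo
`Γ`. For `g : K`, let `w_g x` be the change of the truncated height under `x ↦ x g`. If conjugation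
by powers of `a` or of `a⁻¹` contracts `g` to the identity, then `w_g` is supported in a set that is
compact modulo `Γ` (`exists_truncate_height_mul_eq`), so that the flux `∫ w_g` over `Γ \ K` is
finite. The elements with finite flux whose right translations preserve Haar measure form a group,
on which the flux is additive. Parabolic elements are contracted, and are commutators of `a` with
parabolic elements, so their flux is zero. As in `SL(2, ℝ)`, `a` is a product of parabolic elements
(`boostMatrix_eq_mul`), so its flux is zero as well. But `w_a` is continuous, nonnegative and not
zero, so the flux of `a` is positive (`not_proper_cocompact_of_contracted_commutators`).

The flux plays the role of Stokes' theorem for the area form of `dS²`, which the height makes the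
differential of a `Γ`-invariant form; in this version no differentiation is needed.
-/

/-! ### Discrete subgroups and fundamental domains -/

section LocallyCompactGroup

open MeasureTheory Filter Topology Set
open scoped Pointwise

variable {K : Type*} [Group K] [TopologicalSpace K]

theorem Subgroup.countable_of_finite_inter_compact [SigmaCompactSpace K] (Γ : Subgroup K)
    (hΓ : ∀ C : Set K, IsCompact C → {γ : Γ | (γ : K) ∈ C}.Finite) : Countable Γ := by
  have h : (univ : Set Γ) = ⋃ n, {γ : Γ | (γ : K) ∈ compactCovering K n} := by
    refine (eq_univ_of_forall fun γ => ?_).symm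
    obtain ⟨n, hn⟩ := exists_mem_compactCovering (γ : K)
    exact mem_iUnion.2 ⟨n, hn⟩
  rw [← countable_univ_iff, h]
  exact countable_iUnion fun n => (hΓ _ (isCompact_compactCovering K n)).countable

variable [IsTopologicalGroup K]

theorem sigmaCompactSpace_of_connected_locallyCompact_group [LocallyCompactSpace K]
    [ConnectedSpace K] : SigmaCompactSpace K := by
  obtain ⟨C, hC, hC1⟩ := exists_compact_mem_nhds (1 : K)
  set S : Set K := C ∪ C⁻¹ with hS
  have hSc : IsCompact S := hC.union hC.inv
  -- the subgroup generated by a compact neighbourhood of `1` is open, hence everything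
  have hopen : IsOpen (Subgroup.closure S : Set K) :=
    Subgroup.isOpen_of_mem_nhds _ (g := 1)
      (mem_of_superset hC1 (subset_union_left.trans Subgroup.subset_closure))
  have htop : (Subgroup.closure S : Set K) = univ :=
    IsClopen.eq_univ ⟨Subgroup.isClosed_of_isOpen _ hopen, hopen⟩ ⟨1, one_mem _⟩
  refine ⟨⟨fun n => S ^ n, fun n => ?_, ?_⟩⟩
  · induction n with
    | zero => simp
    | succ n ih => simpa only [pow_succ] using ih.mul hSc
  · refine eq_univ_of_forall fun x => ?_
    have hx : x ∈ Subgroup.closure S := by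
      have : x ∈ (univ : Set K) := mem_univ x
      rwa [← htop] at this
    have hinv : S⁻¹ = S := by rw [hS, union_inv, inv_inv, union_comm]
    induction hx using Subgroup.closure_induction with
    | mem y hy => exact mem_iUnion.2 ⟨1, by simpa using hy⟩
    | one => exact mem_iUnion.2 ⟨0, by simp⟩
    | mul y z _ _ hy hz =>
      obtain ⟨m, hm⟩ := mem_iUnion.1 hy
      obtain ⟨n, hn⟩ := mem_iUnion.1 hz
      exact mem_iUnion.2 ⟨m + n, by simpa only [pow_add] using mul_mem_mul hm hn⟩
    | inv y _ hy =>
      obtain ⟨m, hm⟩ := mem_iUnion.1 hy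
      refine mem_iUnion.2 ⟨m, ?_⟩
      have : y⁻¹ ∈ (S ^ m)⁻¹ := by simpa using hm
      simpa only [← inv_pow, hinv] using this

theorem Subgroup.exists_isFundamentalDomain [LocallyCompactSpace K] [T2Space K]
    [SigmaCompactSpace K] [MeasurableSpace K] [BorelSpace K] (Γ : Subgroup K)
    (hΓ : ∀ C : Set K, IsCompact C → {γ : Γ | (γ : K) ∈ C}.Finite) (μ : Measure K) :
    ∃ F : Set K, IsFundamentalDomain Γ F μ := by
  have := Γ.countable_of_finite_inter_compact hΓ
  -- a neighbourhood of `1` meeting `Γ` only in `1`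
  obtain ⟨U, hU1, hU⟩ : ∃ U ∈ 𝓝 (1 : K), ∀ γ : Γ, (γ : K) ∈ U → γ = 1 := by
    obtain ⟨C, hC, hC1⟩ := exists_compact_mem_nhds (1 : K)
    have hfin : ((fun γ : Γ => (γ : K)) '' ({γ : Γ | (γ : K) ∈ C} \ {1})).Finite :=
      ((hΓ C hC).subset sdiff_subset).image _
    refine ⟨C ∩ ((fun γ : Γ => (γ : K)) '' ({γ : Γ | (γ : K) ∈ C} \ {1}))ᶜ,
      inter_mem hC1 (hfin.isClosed.isOpen_compl.mem_nhds ?_), fun γ hγ => ?_⟩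
    · rintro ⟨γ, hγ, h1⟩
      exact hγ.2 (Subtype.ext h1)
    · by_contra hne
      exact hγ.2 ⟨γ, ⟨hγ.1, hne⟩, rfl⟩
  obtain ⟨V, hV, hVo, hVU⟩ : ∃ V ∈ 𝓝 (1 : K), IsOpen V ∧ ∀ v ∈ V, ∀ w ∈ V, v / w ∈ U := by
    obtain ⟨V, hV, h⟩ := exists_nhds_split_inv hU1
    obtain ⟨W, hWV, hWo, hW1⟩ := mem_nhds_iff.1 hV
    exact ⟨W, hWo.mem_nhds hW1, hWo, fun v hv w hw => h v (hWV hv) w (hWV hw)⟩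
  -- right translates of `V` inject into the quotient by `Γ`, and countably many of them cover
  obtain ⟨t, htc, ht⟩ := countable_cover_nhds (U := fun k : K => (· * k⁻¹) ⁻¹' V)
    (fun k => (continuous_mul_const k⁻¹).continuousAt.preimage_mem_nhds (by simpa using hV))
  have htne : t.Nonempty := by
    by_contra h
    rw [not_nonempty_iff_eq_empty] at h
    have : (1 : K) ∈ ⋃ x ∈ t, (fun k : K => (· * k⁻¹) ⁻¹' V) x := ht ▸ mem_univ _
    simp [h] at this
  obtain ⟨k, rfl⟩ := htc.exists_eq_range htne
  set W : ℕ → Set K := fun n => (· * (k n)⁻¹) ⁻¹' V with hW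
  have hWo : ∀ n, IsOpen (W n) := fun n => hVo.preimage (continuous_mul_const _)
  have hWcov : ∀ x, ∃ n, x ∈ W n := fun x => by
    have : x ∈ ⋃ y ∈ range k, (fun k : K => (· * k⁻¹) ⁻¹' V) y := ht ▸ mem_univ _
    simpa [hW] using this
  have hWinj : ∀ n x (γ : Γ), x ∈ W n → (γ : K) * x ∈ W n → γ = 1 := fun n x γ hx hγ => by
    refine hU γ ?_
    have := hVU _ hγ _ hx
    simpa [div_eq_mul_inv, mul_assoc] using this
  set O : ℕ → Set K := fun n => ⋃ γ : Γ, (fun x => (γ : K) * x) ⁻¹' W n with hO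
  have hOo : ∀ n, IsOpen (O n) := fun n =>
    isOpen_iUnion fun γ => (hWo n).preimage (continuous_const_mul _)
  have hOΓ : ∀ n x (γ : Γ), (γ : K) * x ∈ O n ↔ x ∈ O n := fun n x γ => by
    simp only [hO, mem_iUnion, mem_preimage]
    constructor
    · rintro ⟨δ, h⟩; exact ⟨δ * γ, by simpa [mul_assoc] using h⟩
    · rintro ⟨δ, h⟩; exact ⟨δ * γ⁻¹, by simpa [mul_assoc] using h⟩
  have hWO : ∀ n, W n ⊆ O n := fun n x hx => mem_iUnion.2 ⟨1, by simpa using hx⟩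
  refine ⟨⋃ n, W n \ ⋃ m < n, O m, IsFundamentalDomain.mk' ?_ fun x => ?_⟩
  · refine (MeasurableSet.iUnion fun n => (hWo n).measurableSet.diff ?_).nullMeasurableSet
    exact (isOpen_biUnion fun m _ => hOo m).measurableSet
  · classical
    have hex : ∃ n, x ∈ O n := (hWcov x).imp fun n hn => hWO n hn
    have hmin : ∀ n (γ : Γ), (γ : K) * x ∈ W n \ ⋃ m < n, O m → n = Nat.find hex := by
      rintro n γ ⟨h1, h2⟩
      refine le_antisymm ?_ (Nat.find_min' hex ((hOΓ _ _ γ).1 (hWO _ h1)))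
      by_contra! hlt
      exact h2 (mem_biUnion hlt ((hOΓ _ _ γ).2 (Nat.find_spec hex)))
    obtain ⟨γ, hγ⟩ := mem_iUnion.1 (Nat.find_spec hex)
    refine ⟨γ, mem_iUnion.2 ⟨Nat.find hex, hγ, fun h => ?_⟩, fun δ hδ => ?_⟩
    · obtain ⟨m, hm, h⟩ := mem_iUnion₂.1 h
      exact Nat.find_min hex hm ((hOΓ _ _ γ).1 h)
    · obtain ⟨n, hn⟩ := mem_iUnion.1 hδ
      obtain rfl := hmin n δ hn
      have h3 := hWinj _ _ (δ * γ⁻¹) hγ (by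
        simpa [Subgroup.smul_def, mul_assoc] using hn.1)
      exact mul_inv_eq_one.1 h3

/-! ### Integration of functions invariant under a discrete subgroup -/

/-- Right translations that preserve `μ` permute the fundamental domains for left translations. -/
theorem MeasureTheory.IsFundamentalDomain.preimage_mul_right {K : Type*} [Group K]
    [MeasurableSpace K] {Γ : Subgroup K} {μ : Measure K}
    {F : Set K} (hF : IsFundamentalDomain Γ F μ) (h : K)
    (hh : MeasurePreserving (· * h) μ μ) : IsFundamentalDomain Γ ((· * h) ⁻¹' F) μ :=
  hF.preimage_of_equiv (e := id) hh.quasiMeasurePreserving Function.bijective_id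
    (fun γ x => by simp [Subgroup.smul_def, mul_assoc])

variable [MeasurableSpace K] [BorelSpace K]

variable {Γ : Subgroup K} [Countable Γ] {μ : Measure K} [μ.IsMulLeftInvariant] {F : Set K}

theorem integrableOn_comp_mul_right_iff (hF : IsFundamentalDomain Γ F μ) {h : K}
    (hh : MeasurePreserving (· * h) μ μ) {w : K → ℝ} (hw : ∀ γ : Γ, ∀ x, w (γ * x) = w x) :
    IntegrableOn (fun x => w (x * h)) F μ ↔ IntegrableOn w F μ := by
  rw [hF.integrableOn_iff (hF.preimage_mul_right h hh)
    (fun γ x => by simp only [Subgroup.smul_def, smul_eq_mul, mul_assoc, hw])]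
  exact hh.integrableOn_comp_preimage (measurableEmbedding_mulRight h)

theorem setIntegral_comp_mul_right (hF : IsFundamentalDomain Γ F μ) {h : K}
    (hh : MeasurePreserving (· * h) μ μ) {w : K → ℝ} (hw : ∀ γ : Γ, ∀ x, w (γ * x) = w x) :
    ∫ x in F, w (x * h) ∂μ = ∫ x in F, w x ∂μ := by
  rw [hF.setIntegral_eq (hF.preimage_mul_right h hh)
    (fun γ x => by simp only [Subgroup.smul_def, smul_eq_mul, mul_assoc, hw])]
  exact hh.setIntegral_preimage_emb (measurableEmbedding_mulRight h) w F

theorem integrableOn_of_support_subset_orbit_compact [IsFiniteMeasureOnCompacts μ]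
    (hF : IsFundamentalDomain Γ F μ) {w : K → ℝ} (hwc : Continuous w) {M : ℝ}
    (hwM : ∀ x, |w x| ≤ M) {C : Set K} (hC : IsCompact C)
    (hsupp : ∀ x, w x ≠ 0 → ∃ γ : Γ, (γ : K) * x ∈ C) : IntegrableOn w F μ := by
  have hle : μ (Function.support w ∩ F) ≤ μ C := by
    calc μ (Function.support w ∩ F) ≤ μ (⋃ γ : Γ, γ • C ∩ F) := by
          refine measure_mono fun x hx => ?_
          obtain ⟨γ, hγ⟩ := hsupp x hx.1
          exact mem_iUnion.2 ⟨γ⁻¹, mem_smul_set_iff_inv_smul_mem.2 (by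
            simpa [Subgroup.smul_def] using hγ), hx.2⟩
      _ ≤ ∑' γ : Γ, μ (γ • C ∩ F) := measure_iUnion_le _
      _ = μ C := (hF.measure_eq_tsum C).symm
  have h1 : IntegrableOn w (Function.support w ∩ F) μ :=
    Measure.integrableOn_of_bounded (hle.trans_lt hC.measure_lt_top).ne
      hwc.aestronglyMeasurable
      (M := M) (Eventually.of_forall fun x => by simpa using hwM x)
  have hS : MeasurableSet (Function.support w) := (hwc.isOpen_support).measurableSet
  rw [IntegrableOn, ← Measure.restrict_restrict hS] at h1
  exact (integrableOn_iff_integrable_of_support_subset subset_rfl).1 h1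

end LocallyCompactGroup

/-! ### An equivariant height function -/

section Flux

open MeasureTheory Filter Topology Set
open scoped Pointwise

variable {K : Type*} [Group K] [TopologicalSpace K] [IsTopologicalGroup K]

/-- If `Γ × ℤ` acts properly and cocompactly on `K` by `(γ, n) • x = γ x aⁿ`, then there is a
`Γ`-invariant continuous function on `K` which right translation by `a` increases by `1`: the
logarithm of the average of a bump function against the character `(γ, n) ↦ exp (-n)`. -/
theorem exists_equivariant_height [LocallyCompactSpace K] [T2Space K] (Γ : Subgroup K) (a : K)
    (hprop : ∀ C : Set K, IsCompact C →
      {i : Γ × ℤ | ∃ x ∈ C, (i.1 : K) * x * a ^ i.2 ∈ C}.Finite)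
    (hcoc : ∃ C : Set K, IsCompact C ∧ ∀ x, ∃ i : Γ × ℤ, (i.1 : K) * x * a ^ i.2 ∈ C) :
    ∃ f : K → ℝ, Continuous f ∧ (∀ γ : Γ, ∀ x, f (γ * x) = f x) ∧ ∀ x, f (x * a) = f x + 1 := by
  obtain ⟨C, hC, hcov⟩ := hcoc
  obtain ⟨φ, hφ1, -, hφc, hφI⟩ :=
    exists_continuous_one_zero_of_isCompact hC isClosed_empty (disjoint_empty C)
  set g : Γ × ℤ → K → ℝ := fun i x => Real.exp (-i.2) * φ (i.1 * x * a ^ i.2) with hg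
  have hgc : ∀ i, Continuous (g i) := fun i => by
    simp only [hg]; fun_prop
  have hg0 : ∀ i x, 0 ≤ g i x := fun i x => mul_nonneg (Real.exp_pos _).le (hφI _).1
  have hlf : LocallyFinite fun i => Function.support (g i) := by
    intro x
    obtain ⟨N, hN, hNx⟩ := exists_compact_mem_nhds x
    refine ⟨N, hNx, (hprop (N ∪ tsupport φ) (hN.union hφc)).subset ?_⟩
    rintro i ⟨y, hy, hyN⟩
    exact ⟨y, Or.inl hyN, Or.inr (subset_tsupport _ (right_ne_zero_of_mul hy))⟩
  set S : K → ℝ := fun x => ∑ᶠ i, g i x with hS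
  have hSc : Continuous S := continuous_finsum hgc hlf
  have hSpos : ∀ x, 0 < S x := fun x => by
    refine finsum_pos (fun i => hg0 i x) ?_ (hlf.point_finite x)
    obtain ⟨i, hi⟩ := hcov x
    refine ⟨i, mul_pos (Real.exp_pos _) ?_⟩
    rw [hφ1 hi]
    exact one_pos
  refine ⟨fun x => Real.log (S x), hSc.log fun x => (hSpos x).ne', fun γ x => ?_, fun x => ?_⟩
  · have : S (γ * x) = S x := by
      simp only [hS]
      rw [← finsum_comp_equiv ((Equiv.mulRight γ).prodCongr (Equiv.refl ℤ))
        (f := fun i => g i x)]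
      simp [hg, mul_assoc]
    simp only [this]
  · have : S (x * a) = Real.exp 1 * S x := by
      simp only [hS]
      rw [← smul_eq_mul (Real.exp 1), smul_finsum,
        ← finsum_comp_equiv ((Equiv.refl Γ).prodCongr (Equiv.addRight (-1 : ℤ)))
          (f := fun i => g i (x * a))]
      refine finsum_congr fun i => ?_
      have h1 : x * a * a ^ (i.2 + -1) = x * a ^ i.2 := by
        rw [mul_assoc, ← zpow_one_add]; congr 2; ring
      have h2 : Real.exp (-((i.2 + -1 : ℤ) : ℝ)) = Real.exp 1 * Real.exp (-i.2) := by
        rw [← Real.exp_add]; congr 1; push_cast; ring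
      simp only [hg, Equiv.prodCongr_apply, Prod.map_fst, Prod.map_snd, Equiv.refl_apply,
        Equiv.coe_addRight, mul_assoc, smul_eq_mul] at h1 ⊢
      rw [h1, h2, mul_assoc]
    simp only [this]
    rw [Real.log_mul (Real.exp_pos _).ne' (hSpos x).ne', Real.log_exp, add_comm]

/-- The sets on which a height function is bounded are compact modulo `Γ`. -/
theorem exists_compact_of_abs_height_le {Γ : Subgroup K} {a : K}
    (hcoc : ∃ C : Set K, IsCompact C ∧ ∀ x, ∃ i : Γ × ℤ, (i.1 : K) * x * a ^ i.2 ∈ C)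
    {f : K → ℝ} (hf : Continuous f) (hfΓ : ∀ γ : Γ, ∀ x, f (γ * x) = f x)
    (hfa : ∀ x (n : ℤ), f (x * a ^ n) = f x + n) (R : ℝ) :
    ∃ C : Set K, IsCompact C ∧ ∀ x, |f x| ≤ R → ∃ γ : Γ, (γ : K) * x ∈ C := by
  obtain ⟨C, hC, hcov⟩ := hcoc
  obtain ⟨B, hB⟩ := hC.exists_bound_of_continuousOn hf.continuousOn
  obtain ⟨N, hN⟩ := exists_nat_ge (B + R)
  refine ⟨⋃ n ∈ Finset.Icc (-N : ℤ) N, (· * a ^ n) '' C,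
    (Finset.Icc (-N : ℤ) N).isCompact_biUnion fun n _ => hC.image (continuous_mul_const _),
    fun x hx => ?_⟩
  obtain ⟨⟨γ, n⟩, hi⟩ := hcov x
  have h1 := hB _ hi
  simp only [hfa, hfΓ, Real.norm_eq_abs] at h1
  have h2 : |(n : ℝ)| ≤ N := by
    have : |(n : ℝ)| ≤ |f x + n| + |f x| := by
      simpa using abs_sub (f x + n) (f x)
    linarith
  refine ⟨γ, mem_iUnion₂.2 ⟨-n, ?_, _, hi, by simp⟩⟩
  rw [abs_le] at h2
  rw [Finset.mem_Icc]
  constructor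
  · have : (n : ℝ) ≤ (N : ℤ) := by exact_mod_cast h2.2
    have := Int.cast_le.1 this
    omega
  · have : ((-N : ℤ) : ℝ) ≤ n := by exact_mod_cast h2.1
    have := Int.cast_le.1 this
    omega

/-! ### The effect of contracted elements on the truncated height -/

/-- Truncation of real numbers to the interval `[-1, 1]`. It is odd, so that reversing the sign of a
height function reverses the sign of its truncation. -/
noncomputable def truncate (t : ℝ) : ℝ := max (-1) (min t 1)

theorem continuous_truncate : Continuous truncate := by
  unfold truncate; fun_prop

theorem monotone_truncate : Monotone truncate := fun s t h => by
  unfold truncate; gcongr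

theorem abs_truncate_le (t : ℝ) : |truncate t| ≤ 1 := by
  unfold truncate
  exact abs_le.2 ⟨le_max_left _ _, max_le (by norm_num) (min_le_right _ _)⟩

theorem truncate_of_one_le {t : ℝ} (h : 1 ≤ t) : truncate t = 1 := by
  simp [truncate, h]

theorem truncate_of_le_neg_one {t : ℝ} (h : t ≤ -1) : truncate t = -1 := by
  rw [truncate, min_eq_left (by linarith), max_eq_left h]

theorem truncate_neg (t : ℝ) : truncate (-t) = -truncate t := by
  simp only [truncate, max_def, min_def]
  split_ifs <;> linarith

/-- If `a⁻ᵐ u aᵐ → 1` then, far below level zero, right translation by `u` raises the height by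
less than `1`: such a point is `x = x₀ a⁻ᵐ` with `x₀` between the levels `0` and `1`, and
`f (x u) - f x = f (x₀ a⁻ᵐ u aᵐ) - f x₀`. -/
theorem exists_height_mul_lt {Γ : Subgroup K} {a u : K}
    {f : K → ℝ} (hf : Continuous f) (hfΓ : ∀ γ : Γ, ∀ x, f (γ * x) = f x)
    (hfa : ∀ x (n : ℤ), f (x * a ^ n) = f x + n)
    (hcpt : ∃ C : Set K, IsCompact C ∧ ∀ x, |f x| ≤ 1 → ∃ γ : Γ, (γ : K) * x ∈ C)
    (hu : Tendsto (fun m : ℕ => (a ^ m)⁻¹ * u * a ^ m) atTop (𝓝 1)) :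
    ∃ N : ℝ, ∀ x, f x ≤ -N → f (x * u) < f x + 1 := by
  obtain ⟨C, hC, hcov⟩ := hcpt
  have h1 : ∀ᶠ v in 𝓝 (1 : K), ∀ x ∈ C, f (x * v) < f x + 1 := by
    refine hC.eventually_forall_of_forall_eventually fun x _ => ?_
    have hc : Continuous fun z : K × K => f (z.2 * z.1) - f z.2 := by fun_prop
    have := (hc.tendsto ((1 : K), x)).eventually_lt_const (u := 1) (by simp)
    filter_upwards [this] with z hz
    linarith
  obtain ⟨N, hN⟩ := eventually_atTop.1 (hu.eventually h1)
  refine ⟨N, fun x hx => ?_⟩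
  have hm0 := Nat.le_ceil (-f x)
  have hm1 := Nat.ceil_lt_add_one (a := -f x) (by linarith [(Nat.cast_nonneg N : (0 : ℝ) ≤ N)])
  have hmN : N ≤ ⌈-f x⌉₊ := by
    have : (N : ℝ) ≤ ⌈-f x⌉₊ := by linarith
    exact_mod_cast this
  set m := ⌈-f x⌉₊
  have hx0 : f (x * a ^ m) = f x + m := by simpa using hfa x m
  obtain ⟨γ, hγ⟩ := hcov (x * a ^ m) (by rw [hx0, abs_le]; constructor <;> linarith)
  have h2 := hN m hmN _ hγ
  have h3 : f (x * u * a ^ m) = f (x * u) + m := by simpa using hfa (x * u) m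
  rw [mul_assoc, hfΓ, hfΓ, hx0, show x * a ^ m * ((a ^ m)⁻¹ * u * a ^ m) = x * u * a ^ m by group,
    h3] at h2
  linarith

/-- If `a⁻ᵐ u aᵐ → 1`, then right translation by `u` changes the truncated height only on a set
where the height is bounded. -/
theorem exists_truncate_height_mul_eq {Γ : Subgroup K} {a u : K}
    {f : K → ℝ} (hf : Continuous f) (hfΓ : ∀ γ : Γ, ∀ x, f (γ * x) = f x)
    (hfa : ∀ x (n : ℤ), f (x * a ^ n) = f x + n)
    (hcpt : ∀ R : ℝ, ∃ C : Set K, IsCompact C ∧ ∀ x, |f x| ≤ R → ∃ γ : Γ, (γ : K) * x ∈ C)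
    (hu : Tendsto (fun m : ℕ => (a ^ m)⁻¹ * u * a ^ m) atTop (𝓝 1)) :
    ∃ R : ℝ, ∀ x, R < |f x| → truncate (f (x * u)) = truncate (f x) := by
  obtain ⟨N, hN⟩ := exists_height_mul_lt hf hfΓ hfa (hcpt 1) hu
  obtain ⟨N', hN'⟩ := exists_height_mul_lt hf hfΓ hfa (hcpt 1) (u := u⁻¹) (by
    simpa [mul_assoc] using hu.inv)
  obtain ⟨C, hC, hcov⟩ := hcpt (max N' 1)
  obtain ⟨B, hB⟩ := hC.exists_bound_of_continuousOn
    (f := fun y => f (y * u⁻¹)) (by fun_prop)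
  refine ⟨max (max N 2) (max B 2), fun x hx => ?_⟩
  -- far below, both heights are at most `-1`; far above, both are at least `1`, because `u⁻¹`
  -- cannot raise a height below `1` to more than `B` or `2`
  simp only [max_lt_iff] at hx
  rcases le_total 0 (f x) with h0 | h0
  · rw [abs_of_nonneg h0] at hx
    have h1 : 1 ≤ f (x * u) := by
      by_contra! hlt
      have key : f (x * u * u⁻¹) = f x := by simp
      rcases le_total (f (x * u)) (-N') with h | h
      · have := hN' _ h
        linarith
      · obtain ⟨γ, hγ⟩ := hcov (x * u) (abs_le.2
          ⟨by linarith [le_max_left N' 1], by linarith [le_max_right N' 1]⟩)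
        have := hB _ hγ
        rw [mul_assoc, hfΓ, key] at this
        linarith [le_abs_self (f x), Real.norm_eq_abs (f x)]
    rw [truncate_of_one_le h1, truncate_of_one_le (by linarith)]
  · rw [abs_of_nonpos h0] at hx
    have := hN x (by linarith)
    rw [truncate_of_le_neg_one (by linarith), truncate_of_le_neg_one (by linarith)]

/-! ### The flux of the height function -/

theorem measurePreserving_mul_right_of_modularCharacter_eq_one [LocallyCompactSpace K]
    [MeasurableSpace K] [BorelSpace K] (μ : Measure K) [μ.IsHaarMeasure] [μ.InnerRegular] {h : K}
    (hh : Measure.modularCharacter h = 1) : MeasurePreserving (· * h) μ μ := by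
  refine ⟨measurable_mul_const h, ?_⟩
  rw [Measure.map_right_mul_eq_modularCharacterFun_smul]
  change Measure.modularCharacter h • μ = μ
  rw [hh, one_smul]

/-- Let `Γ × ℤ` act on a connected locally compact group `K` by `(γ, n) • x = γ x aⁿ`. If `a` is
a product of elements which are contracted by conjugation with powers of `a` or of `a⁻¹` and which
are commutators with `a`, then this action cannot be both proper and cocompact.

Let `f` be an equivariant height and `w_g x` the change of the truncation of `f` under right
translation by `g`. The flux `g ↦ ∫ w_g` over `Γ \ K` is additive in `g`, so it vanishes on
commutators and hence at `a`; but `w_a` is nonnegative and not zero. -/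
theorem not_proper_cocompact_of_contracted_commutators [LocallyCompactSpace K] [T2Space K]
    [ConnectedSpace K] (Γ : Subgroup K) (a : K) (S : Set K)
    (hcontr : ∀ u ∈ S, Tendsto (fun m : ℕ => (a ^ m)⁻¹ * u * a ^ m) atTop (𝓝 1) ∨
      Tendsto (fun m : ℕ => a ^ m * u * (a ^ m)⁻¹) atTop (𝓝 1))
    (hcomm : ∀ u ∈ S, ∃ v ∈ S, u = a * v * a⁻¹ * v⁻¹)
    (ha : a ∈ Subgroup.closure S)
    (hprop : ∀ C : Set K, IsCompact C →
      {i : Γ × ℤ | ∃ x ∈ C, (i.1 : K) * x * a ^ i.2 ∈ C}.Finite)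
    (hcoc : ∃ C : Set K, IsCompact C ∧ ∀ x, ∃ i : Γ × ℤ, (i.1 : K) * x * a ^ i.2 ∈ C) :
    False := by
  have := sigmaCompactSpace_of_connected_locallyCompact_group (K := K)
  borelize K
  set μ : Measure K := Measure.haar
  have hΓ : ∀ C : Set K, IsCompact C → {γ : Γ | (γ : K) ∈ C}.Finite := fun C hC => by
    refine ((hprop (insert 1 C) (hC.insert 1)).preimage
      (f := fun γ : Γ => (γ, (0 : ℤ))) (fun _ _ _ _ h => congrArg Prod.fst h)).subset ?_
    intro γ hγ
    exact ⟨1, mem_insert _ _, mem_insert_of_mem _ (by simpa using hγ)⟩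
  have := Γ.countable_of_finite_inter_compact hΓ
  obtain ⟨F, hF⟩ := Γ.exists_isFundamentalDomain hΓ μ
  obtain ⟨f, hf, hfΓ, hfa1⟩ := exists_equivariant_height Γ a hprop hcoc
  have hfa : ∀ x (n : ℤ), f (x * a ^ n) = f x + n := fun x n => by
    induction n with
    | zero => simp
    | succ n ih => rw [zpow_add_one, ← mul_assoc, hfa1, ih]; push_cast; ring
    | pred n ih =>
      have := hfa1 (x * a ^ (-(n : ℤ) - 1))
      rw [mul_assoc, ← zpow_add_one, sub_add_cancel, ih] at this
      push_cast at this ⊢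
      linarith
  have hcpt := exists_compact_of_abs_height_le hcoc hf hfΓ hfa
  set w : K → K → ℝ := fun g x => truncate (f (x * g)) - truncate (f x) with hw
  have hwc : ∀ g, Continuous (w g) := fun g =>
    (continuous_truncate.comp (hf.comp (continuous_mul_const g))).sub (continuous_truncate.comp hf)
  have hwΓ : ∀ g, ∀ γ : Γ, ∀ x, w g (γ * x) = w g x := fun g γ x => by
    simp only [hw, mul_assoc, hfΓ]
  have hint : ∀ g, (∃ R : ℝ, ∀ x, R < |f x| → truncate (f (x * g)) = truncate (f x)) →
      IntegrableOn (w g) F μ := by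
    rintro g ⟨R, hR⟩
    obtain ⟨C, hC, hcov⟩ := hcpt R
    refine integrableOn_of_support_subset_orbit_compact hF (hwc g) (M := 2) (fun x => ?_) hC
      fun x hx => hcov x ?_
    · have h1 := abs_le.1 (abs_truncate_le (f (x * g)))
      have h2 := abs_le.1 (abs_truncate_le (f x))
      exact abs_le.2 ⟨by simp only [hw]; linarith, by simp only [hw]; linarith⟩
    · by_contra! h
      exact hx (sub_eq_zero.2 (hR x h))
  -- the elements with a flux form a subgroup, on which the flux is additive
  set P : K → Prop := fun g => Measure.modularCharacter g = 1 ∧ IntegrableOn (w g) F μ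
  set c : K → ℝ := fun g => ∫ x in F, w g x ∂μ with hc
  have hmp : ∀ g, P g → MeasurePreserving (· * g) μ μ := fun g hg =>
    measurePreserving_mul_right_of_modularCharacter_eq_one μ hg.1
  have hw_mul : ∀ g h, w (g * h) = (fun x => w h (x * g)) + w g := fun g h => by
    funext x; simp [hw, mul_assoc]
  have hmul : ∀ g h, P g → P h → P (g * h) ∧ c (g * h) = c g + c h := fun g h hg hh => by
    have hi := (integrableOn_comp_mul_right_iff hF (hmp g hg) (hwΓ h)).2 hh.2
    refine ⟨⟨by rw [map_mul, hg.1, hh.1, one_mul], ?_⟩, ?_⟩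
    · rw [hw_mul]
      exact hi.add hg.2
    · simp only [hc, hw_mul]
      rw [← setIntegral_comp_mul_right hF (hmp g hg) (hwΓ h), add_comm (∫ x in F, w g x ∂μ)]
      exact integral_add hi hg.2
  have hone : P 1 ∧ c 1 = 0 := by
    have : w 1 = 0 := by funext x; simp [hw]
    exact ⟨⟨map_one _, by rw [this]; exact integrableOn_zero⟩, by simp [hc, this]⟩
  have hinv : ∀ g, P g → P g⁻¹ ∧ c g⁻¹ = - c g := fun g hg => by
    have hg' : Measure.modularCharacter g⁻¹ = 1 := by rw [map_inv, hg.1, inv_one]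
    have hp := measurePreserving_mul_right_of_modularCharacter_eq_one μ hg'
    have : w g⁻¹ = -fun x => w g (x * g⁻¹) := by funext x; simp [hw]
    have hP' : P g⁻¹ := ⟨hg', by
      rw [this]
      exact ((integrableOn_comp_mul_right_iff hF hp (hwΓ g)).2 hg.2).neg⟩
    refine ⟨hP', ?_⟩
    have := (hmul g g⁻¹ hg hP').2
    rw [mul_inv_cancel, hone.2] at this
    linarith
  -- `Subgroup.closure S` lies in the kernel of the modular character
  have hmodS : ∀ u ∈ S, Measure.modularCharacter u = 1 := fun u hu => by
    obtain ⟨v, -, rfl⟩ := hcomm u hu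
    have h0 : ∀ g : K, Measure.modularCharacter g ≠ 0 := fun g =>
      (Measure.modularCharacterFun_pos g).ne'
    simp only [map_mul, map_inv]
    field_simp [h0 a, h0 v]
  have hmod : Measure.modularCharacter a = 1 := by
    have : Subgroup.closure S ≤ (Measure.modularCharacter (G := K)).ker :=
      (Subgroup.closure_le _).2 hmodS
    exact this ha
  have hPa : P a := by
    refine ⟨hmod, hint a ⟨2, fun x hx => ?_⟩⟩
    rw [hfa1]
    rcases lt_abs.1 hx with h | h
    · rw [truncate_of_one_le (by linarith), truncate_of_one_le (by linarith)]
    · rw [truncate_of_le_neg_one (by linarith), truncate_of_le_neg_one (by linarith)]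
  have hPS : ∀ u ∈ S, P u := fun u hu => by
    refine ⟨hmodS u hu, hint u ?_⟩
    rcases hcontr u hu with h | h
    · exact exists_truncate_height_mul_eq hf hfΓ hfa hcpt h
    · -- reversing the height exchanges `a` and `a⁻¹`
      obtain ⟨R, hR⟩ := exists_truncate_height_mul_eq (Γ := Γ) (f := fun x => -f x) (a := a⁻¹)
        (u := u) hf.neg (fun γ x => by rw [hfΓ]) (fun x n => by
          rw [inv_zpow', hfa]; push_cast; ring)
        (fun R => by simpa using hcpt R) (by simpa using h)
      exact ⟨R, fun x hx => by simpa [truncate_neg] using hR x (by simpa using hx)⟩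
  have hcS : ∀ u ∈ S, c u = 0 := fun u hu => by
    obtain ⟨v, hv, rfl⟩ := hcomm u hu
    have h1 := hmul a v hPa (hPS v hv)
    have h2 := hmul _ a⁻¹ h1.1 (hinv a hPa).1
    have h3 := hmul _ v⁻¹ h2.1 (hinv v (hPS v hv)).1
    rw [h3.2, h2.2, h1.2, (hinv a hPa).2, (hinv v (hPS v hv)).2]
    ring
  have hca : c a = 0 := by
    have : ∀ g ∈ Subgroup.closure S, P g ∧ c g = 0 := fun g hg => by
      induction hg using Subgroup.closure_induction with
      | mem u hu => exact ⟨hPS u hu, hcS u hu⟩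
      | one => exact hone
      | mul g h _ _ hg hh =>
        have := hmul g h hg.1 hh.1
        exact ⟨this.1, by rw [this.2, hg.2, hh.2, add_zero]⟩
      | inv g _ hg =>
        have := hinv g hg.1
        exact ⟨this.1, by rw [this.2, hg.2, neg_zero]⟩
    exact (this a ha).2
  -- but the flux of `a` is the integral of a nonnegative function which is positive somewhere
  have hwa0 : ∀ x, 0 ≤ w a x := fun x =>
    sub_nonneg.2 (monotone_truncate (by rw [hfa1]; linarith))
  have hae : w a =ᵐ[μ.restrict F] 0 :=
    (setIntegral_eq_zero_iff_of_nonneg_ae (Eventually.of_forall hwa0) hPa.2).1 hca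
  have haeK : w a =ᵐ[μ] 0 := by
    have h0 : μ (Function.support (w a)) = 0 := by
      refine hF.measure_zero_of_invariant _ (fun γ => ?_) ?_
      · ext x
        simp [mem_smul_set_iff_inv_smul_mem, Subgroup.smul_def, ← Subgroup.coe_inv, hwΓ,
          -InvMemClass.coe_inv]
      · have := (ae_iff.1 hae)
        rwa [Measure.restrict_apply] at this
        exact ((hwc a).isOpen_support).measurableSet
    exact ae_iff.2 h0
  have hwa : w a = 0 := ((hwc a).ae_eq_iff_eq μ continuous_const).1 haeK
  have h1 := congrFun hwa (a ^ (-⌊f 1⌋))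
  have h2 : f (a ^ (-⌊f 1⌋)) = Int.fract (f 1) := by
    have := hfa 1 (-⌊f 1⌋)
    rw [one_mul] at this
    rw [this]; push_cast; rw [← sub_eq_add_neg]; rfl
  have h3 := Int.fract_lt_one (f 1)
  have h4 := Int.fract_nonneg (f 1)
  simp only [hw, hfa1, h2, Pi.zero_apply] at h1
  rw [truncate_of_one_le (by linarith), truncate, min_eq_left h3.le,
    max_eq_right (by linarith)] at h1
  linarith

end Flux

/-! ### The Lorentz group and de Sitter space -/

section Lorentz

open Topology

/-- The Gram matrix of the quadratic form `minkowskiQ`. -/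
def minkowskiJ : Matrix (Fin 3) (Fin 3) ℝ := !![-1, 0, 0; 0, 1, 0; 0, 0, 1]

theorem minkowskiJ_mul_self : minkowskiJ * minkowskiJ = 1 := by
  ext i j; fin_cases i <;> fin_cases j <;> simp [minkowskiJ, Matrix.mul_apply, Fin.sum_univ_three]

theorem minkowskiQ_eq_dotProduct (x : Fin 3 → ℝ) :
    minkowskiQ x = x ⬝ᵥ minkowskiJ *ᵥ x := by
  simp [minkowskiQ, minkowskiJ, Matrix.mulVec, dotProduct, Fin.sum_univ_three]
  ring

/-- The matrix of an element of `O⁰(1,2)`. -/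
def O12Zero.mat (g : O12Zero) : Matrix (Fin 3) (Fin 3) ℝ := (g : O12).val.val

theorem O12Zero.mat_one : O12Zero.mat 1 = 1 := rfl

theorem O12Zero.mat_mul (g h : O12Zero) : (g * h).mat = g.mat * h.mat := rfl

theorem O12Zero.mat_injective : Function.Injective O12Zero.mat := fun _ _ h =>
  Subtype.ext (Subtype.ext (Units.ext h))

theorem O12Zero.continuous_mat : Continuous O12Zero.mat :=
  Units.continuous_val.comp (continuous_subtype_val.comp continuous_subtype_val)

theorem O12Zero.smul_val (g : O12Zero) (x : DeSitter2) : (g • x).val = g.mat *ᵥ x.val := rfl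

theorem O12Zero.minkowskiQ_mat_mulVec (g : O12Zero) (x : Fin 3 → ℝ) :
    minkowskiQ (g.mat *ᵥ x) = minkowskiQ x := (g : O12).property x

instance : PreconnectedSpace O12Zero :=
  Subtype.preconnectedSpace isPreconnected_connectedComponent

/-- A connected family of Lorentz matrices through the identity is a family in `O⁰(1,2)`. -/
theorem exists_continuousMap_O12Zero {X : Type*} [TopologicalSpace X] [PreconnectedSpace X]
    {A : X → Matrix (Fin 3) (Fin 3) ℝ} (hA : Continuous A)
    (hJ : ∀ x, (A x)ᵀ * minkowskiJ * A x = minkowskiJ) {x₀ : X} (h0 : A x₀ = 1) :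
    ∃ F : C(X, O12Zero), ∀ x, (F x).mat = A x := by
  have hinv : ∀ x, minkowskiJ * (A x)ᵀ * minkowskiJ * A x = 1 := fun x => by
    rw [mul_assoc, mul_assoc, ← mul_assoc (A x)ᵀ, hJ, minkowskiJ_mul_self]
  let U : X → GL (Fin 3) ℝ := fun x =>
    ⟨A x, minkowskiJ * (A x)ᵀ * minkowskiJ, mul_eq_one_comm.1 (hinv x), hinv x⟩
  have hUc : Continuous U := by
    refine Units.continuous_iff.2 ⟨hA, ?_⟩
    change Continuous fun x => minkowskiJ * (A x)ᵀ * minkowskiJ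
    fun_prop
  have hUO : ∀ x, U x ∈ O12 := fun x y => by
    change minkowskiQ (A x *ᵥ y) = _
    rw [minkowskiQ_eq_dotProduct, minkowskiQ_eq_dotProduct]
    conv_rhs => rw [← hJ x, ← Matrix.mulVec_mulVec, ← Matrix.mulVec_mulVec,
      Matrix.dotProduct_mulVec y (A x)ᵀ, Matrix.vecMul_transpose]
  let V : X → O12 := fun x => ⟨U x, hUO x⟩
  have hVc : Continuous V := hUc.subtype_mk _
  have hV0 : V x₀ = 1 := Subtype.ext (Units.ext h0)
  have hVmem : ∀ x, V x ∈ Subgroup.connectedComponentOfOne O12 := fun x =>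
    (isPreconnected_range hVc).subset_connectedComponent ⟨x₀, hV0⟩ ⟨x, rfl⟩
  exact ⟨⟨fun x => ⟨V x, hVmem x⟩, hVc.subtype_mk _⟩, fun x => rfl⟩

theorem O12Zero.mat_orthogonal (g : O12Zero) : g.matᵀ * minkowskiJ * g.mat = minkowskiJ := by
  have h := g.minkowskiQ_mat_mulVec
  have h0 := h ![1, 0, 0]
  have h1 := h ![0, 1, 0]
  have h2 := h ![0, 0, 1]
  have h01 := h ![1, 1, 0]
  have h02 := h ![1, 0, 1]
  have h12 := h ![0, 1, 1]
  simp [minkowskiQ, Matrix.mulVec, dotProduct, Fin.sum_univ_three] at h0 h1 h2 h01 h02 h12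
  ext i j
  fin_cases i <;> fin_cases j <;>
    simp [minkowskiJ, Matrix.mul_apply, Fin.sum_univ_three] <;> linarith

theorem pos_of_continuous_ne_zero {X : Type*} [TopologicalSpace X] [PreconnectedSpace X]
    {f : X → ℝ} (hf : Continuous f) (h0 : ∀ x, f x ≠ 0) {x₀ : X} (hx₀ : 0 < f x₀) (x : X) :
    0 < f x := by
  by_contra! h
  obtain ⟨y, hy⟩ := mem_range_of_exists_le_of_exists_ge hf ⟨x, h⟩ ⟨x₀, hx₀.le⟩
  exact h0 y hy

theorem O12Zero.mat_zero_zero_pos (g : O12Zero) : 0 < g.mat 0 0 := by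
  refine pos_of_continuous_ne_zero (f := fun g : O12Zero => g.mat 0 0)
    (O12Zero.continuous_mat.matrix_elem 0 0) (fun g h => ?_) (x₀ := 1) ?_ g
  · have := congrFun (congrFun g.mat_orthogonal 0) 0
    simp [minkowskiJ, Matrix.mul_apply, Fin.sum_univ_three, h] at this
    nlinarith [sq_nonneg (g.mat 1 0), sq_nonneg (g.mat 2 0)]
  · simp [O12Zero.mat_one]

theorem O12Zero.det_mat_pos (g : O12Zero) : 0 < g.mat.det := by
  refine pos_of_continuous_ne_zero (f := fun g : O12Zero => g.mat.det)
    O12Zero.continuous_mat.matrix_det (fun g => ?_) (x₀ := 1) ?_ g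
  · exact ((Matrix.isUnit_iff_isUnit_det _).1 (g : O12).val.isUnit).ne_zero
  · simp [O12Zero.mat_one]

/-- The base point of de Sitter space. -/
def deSitterBase : DeSitter2 := ⟨![0, 1, 0], by simp [minkowskiQ]⟩

/-- The Lorentz boost in the coordinates `x₀, x₂`. These boosts form the stabilizer of
`deSitterBase` in `O⁰(1,2)`. -/
noncomputable def boostMatrix (t : ℝ) : Matrix (Fin 3) (Fin 3) ℝ :=
  !![Real.cosh t, 0, Real.sinh t; 0, 1, 0; Real.sinh t, 0, Real.cosh t]

/-- The one-parameter group of parabolic elements fixing the null vector `(1, 0, 1)`. -/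
noncomputable def parabolicMatrix (s : ℝ) : Matrix (Fin 3) (Fin 3) ℝ :=
  !![1 + s ^ 2 / 2, s, -s ^ 2 / 2; s, 1, -s; s ^ 2 / 2, s, 1 - s ^ 2 / 2]

/-- The one-parameter group of parabolic elements fixing the null vector `(1, 0, -1)`. -/
noncomputable def parabolicMatrix' (s : ℝ) : Matrix (Fin 3) (Fin 3) ℝ :=
  !![1 + s ^ 2 / 2, s, s ^ 2 / 2; s, 1, s; -s ^ 2 / 2, -s, 1 - s ^ 2 / 2]

/-- A Lorentz matrix, depending continuously on `x`, whose second column is `x`: a boost in the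
coordinates `x₀, x₁` followed by a rotation in the coordinates `x₁, x₂`. -/
noncomputable def frameMatrix (x : DeSitter2) : Matrix (Fin 3) (Fin 3) ℝ :=
  !![√(1 + x.val 0 ^ 2), x.val 0, 0;
    x.val 1 * x.val 0 / √(1 + x.val 0 ^ 2), x.val 1, -(x.val 2 / √(1 + x.val 0 ^ 2));
    x.val 2 * x.val 0 / √(1 + x.val 0 ^ 2), x.val 2, x.val 1 / √(1 + x.val 0 ^ 2)]

theorem continuous_boostMatrix : Continuous boostMatrix := by
  refine continuous_matrix fun i j => ?_
  fin_cases i <;> fin_cases j <;> simp [boostMatrix] <;> fun_prop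

theorem continuous_parabolicMatrix : Continuous parabolicMatrix := by
  refine continuous_matrix fun i j => ?_
  fin_cases i <;> fin_cases j <;> simp [parabolicMatrix] <;> fun_prop

theorem continuous_parabolicMatrix' : Continuous parabolicMatrix' := by
  refine continuous_matrix fun i j => ?_
  fin_cases i <;> fin_cases j <;> simp [parabolicMatrix'] <;> fun_prop

theorem continuous_frameMatrix : Continuous frameMatrix := by
  have h : ∀ i, Continuous fun x : DeSitter2 => x.val i := fun i =>
    (continuous_apply i).comp continuous_subtype_val
  have h0 := h 0
  have h1 := h 1
  have h2 := h 2
  have hs : Continuous fun x : DeSitter2 => √(1 + x.val 0 ^ 2) :=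
    ((h0.pow 2).const_add 1).sqrt
  have hne : ∀ x : DeSitter2, √(1 + x.val 0 ^ 2) ≠ 0 := fun x => by positivity
  refine continuous_matrix fun i j => ?_
  fin_cases i <;> fin_cases j <;> simp only [frameMatrix]
  · exact hs
  · exact h0
  · exact continuous_const
  · exact (h1.mul h0).div hs hne
  · exact h1
  · exact (h2.div hs hne).neg
  · exact (h2.mul h0).div hs hne
  · exact h2
  · exact h1.div hs hne

theorem boostMatrix_zero : boostMatrix 0 = 1 := by
  ext i j; fin_cases i <;> fin_cases j <;> simp [boostMatrix]

theorem parabolicMatrix_zero : parabolicMatrix 0 = 1 := by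
  ext i j; fin_cases i <;> fin_cases j <;> simp [parabolicMatrix]

theorem parabolicMatrix'_zero : parabolicMatrix' 0 = 1 := by
  ext i j; fin_cases i <;> fin_cases j <;> simp [parabolicMatrix']

theorem frameMatrix_base : frameMatrix deSitterBase = 1 := by
  ext i j; fin_cases i <;> fin_cases j <;> simp [frameMatrix, deSitterBase]

theorem boostMatrix_orthogonal (t : ℝ) :
    (boostMatrix t)ᵀ * minkowskiJ * boostMatrix t = minkowskiJ := by
  have := Real.cosh_sq t
  ext i j
  fin_cases i <;> fin_cases j <;>
    simp [boostMatrix, minkowskiJ, Matrix.mul_apply, Fin.sum_univ_three] <;> linarith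

theorem parabolicMatrix_orthogonal (s : ℝ) :
    (parabolicMatrix s)ᵀ * minkowskiJ * parabolicMatrix s = minkowskiJ := by
  ext i j
  fin_cases i <;> fin_cases j <;>
    simp [parabolicMatrix, minkowskiJ, Matrix.mul_apply, Fin.sum_univ_three] <;> ring

theorem parabolicMatrix'_orthogonal (s : ℝ) :
    (parabolicMatrix' s)ᵀ * minkowskiJ * parabolicMatrix' s = minkowskiJ := by
  ext i j
  fin_cases i <;> fin_cases j <;>
    simp [parabolicMatrix', minkowskiJ, Matrix.mul_apply, Fin.sum_univ_three] <;> ring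

theorem frameMatrix_orthogonal (x : DeSitter2) :
    (frameMatrix x)ᵀ * minkowskiJ * frameMatrix x = minkowskiJ := by
  have hx := x.property
  rw [minkowskiQ] at hx
  have hs : √(1 + x.val 0 ^ 2) ^ 2 = 1 + x.val 0 ^ 2 := Real.sq_sqrt (by positivity)
  have hne : √(1 + x.val 0 ^ 2) ≠ 0 := by positivity
  ext i j
  fin_cases i <;> fin_cases j <;>
    simp [frameMatrix, minkowskiJ, Matrix.mul_apply, Fin.sum_univ_three] <;>
    generalize √(1 + x.val 0 ^ 2) = r at * <;> field_simp <;> grind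

theorem frameMatrix_mulVec_base (x : DeSitter2) :
    frameMatrix x *ᵥ deSitterBase.val = x.val := by
  ext i
  fin_cases i <;> simp [frameMatrix, deSitterBase, Matrix.mulVec, dotProduct, Fin.sum_univ_three]

theorem boostMatrix_mulVec_base (t : ℝ) :
    boostMatrix t *ᵥ deSitterBase.val = deSitterBase.val := by
  ext i
  fin_cases i <;> simp [boostMatrix, deSitterBase, Matrix.mulVec, dotProduct, Fin.sum_univ_three]

theorem boostMatrix_add (s t : ℝ) : boostMatrix (s + t) = boostMatrix s * boostMatrix t := by
  ext i j
  fin_cases i <;> fin_cases j <;>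
    simp [boostMatrix, Matrix.mul_apply, Fin.sum_univ_three, Real.cosh_add, Real.sinh_add] <;> ring

theorem parabolicMatrix_add (s t : ℝ) :
    parabolicMatrix (s + t) = parabolicMatrix s * parabolicMatrix t := by
  ext i j
  fin_cases i <;> fin_cases j <;>
    simp [parabolicMatrix, Matrix.mul_apply, Fin.sum_univ_three] <;> ring

theorem parabolicMatrix'_add (s t : ℝ) :
    parabolicMatrix' (s + t) = parabolicMatrix' s * parabolicMatrix' t := by
  ext i j
  fin_cases i <;> fin_cases j <;>
    simp [parabolicMatrix', Matrix.mul_apply, Fin.sum_univ_three] <;> ring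

theorem boostMatrix_mul_parabolicMatrix (t s : ℝ) :
    boostMatrix t * parabolicMatrix s = parabolicMatrix (Real.exp t * s) * boostMatrix t := by
  have h : Real.exp t * Real.exp (-t) = 1 := by rw [← Real.exp_add]; simp
  ext i j
  fin_cases i <;> fin_cases j <;>
    simp [boostMatrix, parabolicMatrix, Matrix.mul_apply, Fin.sum_univ_three, Real.cosh_eq,
      Real.sinh_eq] <;>
    generalize Real.exp (-t) = e' at * <;> generalize Real.exp t = e at * <;> grind

theorem boostMatrix_mul_parabolicMatrix' (t s : ℝ) :
    boostMatrix t * parabolicMatrix' s = parabolicMatrix' (Real.exp (-t) * s) * boostMatrix t := by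
  have h : Real.exp t * Real.exp (-t) = 1 := by rw [← Real.exp_add]; simp
  ext i j
  fin_cases i <;> fin_cases j <;>
    simp [boostMatrix, parabolicMatrix', Matrix.mul_apply, Fin.sum_univ_three, Real.cosh_eq,
      Real.sinh_eq] <;>
    generalize Real.exp (-t) = e' at * <;> generalize Real.exp t = e at * <;> grind

/-- A boost is a product of parabolic elements. This is the image in `O(1,2)` of a factorization
of the diagonal matrix with entries `l, l⁻¹`, `l = exp (t / 2)`, in `SL(2, ℝ)`. -/
theorem boostMatrix_eq_mul (t : ℝ) :
    boostMatrix t = parabolicMatrix (-(Real.exp (t / 2) * (Real.exp (t / 2) - 1))) *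
      parabolicMatrix' (-Real.exp (-(t / 2))) * parabolicMatrix (Real.exp (t / 2) - 1) *
      parabolicMatrix' 1 := by
  have h : Real.exp (t / 2) * Real.exp (-(t / 2)) = 1 := by rw [← Real.exp_add]; simp
  have h1 : Real.exp t = Real.exp (t / 2) ^ 2 := by rw [← Real.exp_nat_mul]; congr 1; ring
  have h2 : Real.exp (-t) = Real.exp (-(t / 2)) ^ 2 := by
    rw [← Real.exp_nat_mul]; congr 1; push_cast; ring
  ext i j
  fin_cases i <;> fin_cases j <;>
    simp [boostMatrix, parabolicMatrix, parabolicMatrix', Matrix.mul_apply, Fin.sum_univ_three,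
      Real.cosh_eq, Real.sinh_eq, h1, h2] <;>
    generalize Real.exp (-(t / 2)) = e' at * <;> generalize Real.exp (t / 2) = e at * <;> grind

/-- The stabilizer of the base point in `O⁰(1,2)` consists of boosts. -/
theorem O12Zero.mat_eq_boostMatrix {g : O12Zero} (hg : g • deSitterBase = deSitterBase) :
    g.mat = boostMatrix (Real.arsinh (g.mat 0 2)) := by
  have hcol : g.mat *ᵥ deSitterBase.val = deSitterBase.val := congrArg Subtype.val hg
  have h01 : g.mat 0 1 = 0 := by
    simpa [deSitterBase, Matrix.mulVec, dotProduct, Fin.sum_univ_three] using congrFun hcol 0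
  have h11 : g.mat 1 1 = 1 := by
    simpa [deSitterBase, Matrix.mulVec, dotProduct, Fin.sum_univ_three] using congrFun hcol 1
  have h21 : g.mat 2 1 = 0 := by
    simpa [deSitterBase, Matrix.mulVec, dotProduct, Fin.sum_univ_three] using congrFun hcol 2
  have ho := fun i j => congrFun (congrFun g.mat_orthogonal i) j
  have h10 : g.mat 1 0 = 0 := by
    simpa [minkowskiJ, Matrix.mul_apply, Fin.sum_univ_three, h01, h11, h21] using ho 1 0
  have h12 : g.mat 1 2 = 0 := by
    simpa [minkowskiJ, Matrix.mul_apply, Fin.sum_univ_three, h01, h11, h21] using ho 1 2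
  have e00 := ho 0 0
  have e02 := ho 0 2
  have e22 := ho 2 2
  have hpos := g.mat_zero_zero_pos
  have hdet := g.det_mat_pos
  simp [minkowskiJ, Matrix.mul_apply, Fin.sum_univ_three, h10, h12] at e00 e02 e22
  simp [Matrix.det_fin_three, h01, h11, h21, h10, h12] at hdet
  -- with `δ` the determinant, `d = a δ`, `b = c δ` and `δ² = 1`
  set δ := g.mat 0 0 * g.mat 2 2 - g.mat 0 2 * g.mat 2 0 with hδ
  have hd' : g.mat 2 2 = g.mat 0 0 * δ := by
    linear_combination g.mat 2 2 * e00 - g.mat 2 0 * e02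
  have hb' : g.mat 0 2 = g.mat 2 0 * δ := by
    linear_combination g.mat 0 2 * e00 - g.mat 0 0 * e02
  have hδ1 : δ = 1 := by
    have : δ ^ 2 = 1 := by
      rw [hd', hb'] at e22
      linear_combination e22 + δ ^ 2 * e00
    nlinarith
  have hd : g.mat 2 2 = g.mat 0 0 := by rw [hd', hδ1, mul_one]
  have hc : g.mat 2 0 = g.mat 0 2 := by rw [hb', hδ1, mul_one]
  have hcosh : g.mat 0 0 = √(1 + g.mat 0 2 ^ 2) := by
    rw [eq_comm, Real.sqrt_eq_iff_mul_self_eq (by positivity) hpos.le]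
    rw [hc] at e00; linarith
  ext i j
  fin_cases i <;> fin_cases j <;>
    simp [boostMatrix, h01, h11, h21, h10, h12, hd, hc, Real.cosh_arsinh, hcosh]

end Lorentz

/-! ### Topology of the spaces involved -/

section Topology

open Topology

/-- A charted space structure on the source of a local homeomorphism, modelled on the target. -/
noncomputable abbrev IsLocalHomeomorph.toChartedSpace {X Y : Type*} [TopologicalSpace X]
    [TopologicalSpace Y] {f : X → Y} (hf : IsLocalHomeomorph f) : ChartedSpace Y X where
  atlas := Set.univ
  chartAt x := (hf x).choose
  mem_chart_source x := (hf x).choose_spec.1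
  chart_mem_atlas _ := Set.mem_univ _

theorem IsCoveringMap.t2Space {X Y : Type*} [TopologicalSpace X]
    [TopologicalSpace Y] [T2Space Y] {f : X → Y} (hf : IsCoveringMap f) : T2Space X := by
  refine ⟨fun x y hxy => ?_⟩
  by_cases h : f x = f y
  · exact hf.isSeparatedMap x y h hxy
  · exact separated_by_continuous hf.continuous h

instance : LocallyCompactSpace O12Zero := by
  have hM : LocallyCompactSpace (Matrix (Fin 3) (Fin 3) ℝ) :=
    inferInstanceAs (LocallyCompactSpace (Fin 3 → Fin 3 → ℝ))
  have hGL : LocallyCompactSpace (GL (Fin 3) ℝ) :=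
    inferInstanceAs (LocallyCompactSpace (Matrix (Fin 3) (Fin 3) ℝ)ˣ)
  have hcl : IsClosed (O12 : Set (GL (Fin 3) ℝ)) := by
    have : (O12 : Set (GL (Fin 3) ℝ)) =
        ⋂ x : Fin 3 → ℝ, {A | minkowskiQ (A.val *ᵥ x) = minkowskiQ x} := by
      ext A; simp [O12]
    rw [this]
    refine isClosed_iInter fun x => isClosed_eq ?_ continuous_const
    have hc : Continuous fun A : GL (Fin 3) ℝ => A.val *ᵥ x :=
      Units.continuous_val.matrix_mulVec continuous_const
    have hi : ∀ i, Continuous fun A : GL (Fin 3) ℝ => (A.val *ᵥ x) i := fun i =>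
      (continuous_apply i).comp hc
    exact (((hi 0).pow 2).neg.add ((hi 1).pow 2)).add ((hi 2).pow 2)
  have hO : LocallyCompactSpace O12 := hcl.isClosedEmbedding_subtypeVal.locallyCompactSpace
  have hcc := isClosed_connectedComponent (x := (1 : O12))
  exact hcc.isClosedEmbedding_subtypeVal.locallyCompactSpace

theorem continuous_minkowskiQ : Continuous minkowskiQ := by
  unfold minkowskiQ; fun_prop

instance : LocallyCompactSpace DeSitter2 :=
  (isClosed_eq continuous_minkowskiQ
    continuous_const).isClosedEmbedding_subtypeVal.locallyCompactSpace

/-- De Sitter space is a retract of the open set of spacelike vectors. -/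
instance : LocallyPathConnectedSpace DeSitter2 := by
  let W : Set (Fin 3 → ℝ) := {x | 0 < minkowskiQ x}
  have hW : IsOpen W := isOpen_lt continuous_const continuous_minkowskiQ
  have := hW.locallyPathConnectedSpace
  have hne : ∀ x : W, √(minkowskiQ x.val) ≠ 0 := fun x => (Real.sqrt_pos.2 x.2).ne'
  let ρ : W → DeSitter2 := fun x => ⟨(√(minkowskiQ x.val))⁻¹ • x.val, by
    have h : ∀ (c : ℝ) (y : Fin 3 → ℝ), minkowskiQ (c • y) = c ^ 2 * minkowskiQ y := fun c y => by
      simp [minkowskiQ]; ring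
    rw [h, inv_pow, Real.sq_sqrt (le_of_lt x.2), inv_mul_cancel₀ (ne_of_gt x.2)]⟩
  have hρ : Continuous ρ := by
    refine Continuous.subtype_mk ?_ _
    exact ((continuous_minkowskiQ.comp continuous_subtype_val).sqrt.inv₀ hne).smul
      continuous_subtype_val
  let ι : DeSitter2 → W := fun x => ⟨x.val, by
    change 0 < minkowskiQ x.val
    rw [x.2]; exact one_pos⟩
  have hι : Continuous ι := continuous_subtype_val.subtype_mk _
  have hρι : Function.LeftInverse ρ ι := fun x => Subtype.ext (by simp [ρ, ι, x.2])
  exact (Topology.IsQuotientMap.of_inverse hι hρ hρι).locallyPathConnectedSpace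

/-- For a cocompact action of a discrete group on a locally compact space, some compact set
meets all orbits. -/
theorem exists_compact_meets_orbits {Γ Y : Type*} [Group Γ] [TopologicalSpace Y]
    [WeaklyLocallyCompactSpace Y] [MulAction Γ Y] [ContinuousConstSMul Γ Y]
    (h : ActsCocompactly Γ Y) : ∃ C : Set Y, IsCompact C ∧ ∀ y, ∃ γ : Γ, γ • y ∈ C := by
  choose N hN hNy using fun y : Y => exists_compact_mem_nhds y
  let π : Y → MulAction.orbitRel.Quotient Γ Y := Quotient.mk''
  have hπ : IsOpenMap π := isOpenMap_quotient_mk'_mul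
  have hcomp : CompactSpace (MulAction.orbitRel.Quotient Γ Y) := h
  obtain ⟨t, ht⟩ := isCompact_univ.elim_finite_subcover (fun y => π '' interior (N y))
    (fun y => hπ _ isOpen_interior) (fun z _ => by
      obtain ⟨y, rfl⟩ := Quotient.exists_rep z
      exact Set.mem_iUnion.2 ⟨y, y, mem_interior_iff_mem_nhds.2 (hNy y), rfl⟩)
  refine ⟨⋃ y ∈ t, N y, t.isCompact_biUnion fun y _ => hN y, fun y => ?_⟩
  obtain ⟨x, hx, z, hz, hzy⟩ := Set.mem_iUnion₂.1 (ht (Set.mem_univ (π y)))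
  obtain ⟨γ, hγ⟩ := MulAction.orbitRel_apply.1 (Quotient.exact hzy)
  exact ⟨γ, Set.mem_iUnion₂.2 ⟨x, hx, by
    change γ • y = z at hγ
    rw [hγ]; exact interior_subset hz⟩⟩

end Topology

/-! ### Lifting to the universal covers -/

section Lift

open Topology Filter

variable {G : Type*} [Group G] [TopologicalSpace G] {p : G →* O12Zero}

theorem IsUniversalCovering.exists_lift (hp : IsUniversalCovering p)
    {X : Type*} [TopologicalSpace X] [SimplyConnectedSpace X] [LocallyPathConnectedSpace X]
    {A : X → Matrix (Fin 3) (Fin 3) ℝ} (hA : Continuous A)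
    (hJ : ∀ x, (A x)ᵀ * minkowskiJ * A x = minkowskiJ) {x₀ : X} (h0 : A x₀ = 1) :
    ∃ F : C(X, G), F x₀ = 1 ∧ ∀ x, (p (F x)).mat = A x := by
  obtain ⟨f, hf⟩ := exists_continuousMap_O12Zero hA hJ h0
  have hf0 : f x₀ = 1 := O12Zero.mat_injective (by rw [hf, h0, O12Zero.mat_one])
  obtain ⟨F, ⟨hF0, hF⟩, -⟩ := hp.isCoveringMap.existsUnique_continuousMap_lifts f x₀ 1
    (by rw [hf0, map_one])
  exact ⟨F, hF0, fun x => by rw [← hf, ← hF]; rfl⟩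

theorem IsUniversalCovering.eq_of_mat_eq (hp : IsUniversalCovering p)
    {X : Type*} [TopologicalSpace X] [PreconnectedSpace X]
    {F₁ F₂ : X → G} (h₁ : Continuous F₁) (h₂ : Continuous F₂)
    (h : ∀ x, (p (F₁ x)).mat = (p (F₂ x)).mat) {x₀ : X} (h0 : F₁ x₀ = F₂ x₀) (x : X) :
    F₁ x = F₂ x :=
  congrFun (hp.isCoveringMap.eq_of_comp_eq h₁ h₂
    (funext fun x => O12Zero.mat_injective (h x)) x₀ h0) x

/-- A one-parameter group of Lorentz matrices lifts to a one-parameter group in `G`. -/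
theorem IsUniversalCovering.exists_lift_add [IsTopologicalGroup G] (hp : IsUniversalCovering p)
    {A : ℝ → Matrix (Fin 3) (Fin 3) ℝ} (hA : Continuous A)
    (hJ : ∀ x, (A x)ᵀ * minkowskiJ * A x = minkowskiJ) (h0 : A 0 = 1)
    (hadd : ∀ s t, A (s + t) = A s * A t) :
    ∃ F : C(ℝ, G), F 0 = 1 ∧ (∀ t, (p (F t)).mat = A t) ∧ ∀ s t, F (s + t) = F s * F t := by
  obtain ⟨F, hF0, hF⟩ := hp.exists_lift hA hJ h0
  refine ⟨F, hF0, hF, fun s t => ?_⟩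
  refine hp.eq_of_mat_eq (F₁ := fun t => F (s + t)) (F₂ := fun t => F s * F t)
    (by fun_prop) (by fun_prop) (fun t => ?_) (x₀ := 0) (by simp [hF0]) t
  rw [map_mul, O12Zero.mat_mul, hF, hF, hF, hadd]

/-- If conjugation by `b` rescales the one-parameter group `F` by a factor `k` with `|k| < 1`,
then its powers contract every `F s` to the identity. -/
theorem tendsto_conj_pow_of_rescale {F : C(ℝ, G)} (hF0 : F 0 = 1) {b : G} {k : ℝ} (hk : |k| < 1)
    (h : ∀ s, b * F s * b⁻¹ = F (k * s)) (s : ℝ) :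
    Tendsto (fun m : ℕ => b ^ m * F s * (b ^ m)⁻¹) atTop (𝓝 1) := by
  have h1 : ∀ m : ℕ, b ^ m * F s * (b ^ m)⁻¹ = F (k ^ m * s) := fun m => by
    induction m with
    | zero => simp
    | succ m ih =>
      rw [pow_succ' k, mul_assoc k, ← h, ← ih, pow_succ' b]
      group
  simp only [h1]
  rw [← hF0]
  refine (F.continuous.tendsto 0).comp ?_
  simpa using (tendsto_pow_atTop_nhds_zero_of_abs_lt_one hk).mul_const s

/-- If conjugation by `a` rescales the one-parameter group `F` by a factor different from `1`,
then every `F s` is a commutator of `a` with an element of `F`. -/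
theorem exists_eq_commutator_of_rescale {F : C(ℝ, G)}
    (hF : ∀ s t, F (s + t) = F s * F t) {a : G} {k : ℝ} (hk : k ≠ 1)
    (h : ∀ s, a * F s * a⁻¹ = F (k * s)) (s : ℝ) :
    ∃ t, F s = a * F t * a⁻¹ * (F t)⁻¹ := by
  refine ⟨s / (k - 1), ?_⟩
  rw [h, eq_mul_inv_iff_mul_eq, ← hF]
  have := sub_ne_zero.2 hk
  congr 1
  field_simp
  ring

end Lift

/-! ### The stabilizer, its generators, and the action on the product -/

section Main

open Topology Filter

/-- The one-parameter subgroup of `G` over the boosts fixes the points over the base point. -/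
theorem IsUniversalCovering.boost_smul_eq {G : Type*} [Group G] [TopologicalSpace G]
    {p : G →* O12Zero} {D : Type*} [TopologicalSpace D] {q : D → DeSitter2}
    (hq : IsUniversalCovering q) [MulAction G D] [ContinuousSMul G D]
    (hlift : ∀ (g : G) (x : D), q (g • x) = p g • q x) {x₀ : D} (hx₀ : q x₀ = deSitterBase)
    {a : C(ℝ, G)} (ha0 : a 0 = 1) (ha : ∀ t, (p (a t)).mat = boostMatrix t) (t : ℝ) :
    a t • x₀ = x₀ := by
  refine congrFun (hq.isCoveringMap.eq_of_comp_eq (g₁ := fun t => a t • x₀) (g₂ := fun _ => x₀)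
    (by fun_prop) continuous_const (funext fun t => ?_) 0 (by simp [ha0])) t
  simp only [Function.comp_apply, hlift, hx₀]
  refine Subtype.ext ?_
  rw [O12Zero.smul_val, ha, boostMatrix_mulVec_base]

/-- The group `G` is the product of the image of a continuous map from `D` and of the
one-parameter group `a` over the boosts: the orthonormal frame `frameMatrix` lifts to `D`. In
particular, `a` is the whole stabilizer of `x₀`. -/
theorem IsUniversalCovering.exists_decomposition {G : Type*} [Group G] [TopologicalSpace G]
    [IsTopologicalGroup G] {p : G →* O12Zero} (hp : IsUniversalCovering p)
    {D : Type*} [TopologicalSpace D] {q : D → DeSitter2}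
    (hq : IsUniversalCovering q) [MulAction G D] [ContinuousSMul G D]
    (hlift : ∀ (g : G) (x : D), q (g • x) = p g • q x) {x₀ : D} (hx₀ : q x₀ = deSitterBase)
    {a : C(ℝ, G)} (ha0 : a 0 = 1) (ha : ∀ t, (p (a t)).mat = boostMatrix t) :
    ∃ (σ : C(D, G)) (r : C(G, ℝ)), (∀ g, g = σ (g • x₀) * a (r g)) ∧ ∀ t, r (a t) = t := by
  have := hp.simplyConnected
  have := hq.simplyConnected
  let cs : ChartedSpace DeSitter2 D := hq.isCoveringMap.isLocalHomeomorph.toChartedSpace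
  have : LocallyPathConnectedSpace D := ChartedSpace.locallyPathConnectedSpace DeSitter2 D
  obtain ⟨σ, hσ0, hσ⟩ := hp.exists_lift (X := D) (A := fun y => frameMatrix (q y))
    (continuous_frameMatrix.comp hq.isCoveringMap.continuous)
    (fun y => frameMatrix_orthogonal _) (x₀ := x₀) (by rw [hx₀, frameMatrix_base])
  have hfix : ∀ g : G, p ((σ (g • x₀))⁻¹ * g) • deSitterBase = deSitterBase := fun g => by
    rw [map_mul, map_inv, mul_smul, inv_smul_eq_iff, ← hx₀, ← hlift]
    refine Subtype.ext ?_
    rw [O12Zero.smul_val, hσ, hx₀, frameMatrix_mulVec_base]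
  let r : C(G, ℝ) := ⟨fun g => Real.arsinh ((p ((σ (g • x₀))⁻¹ * g)).mat 0 2), by
    refine Real.continuous_arsinh.comp ((O12Zero.continuous_mat.matrix_elem 0 2).comp
      (hp.isCoveringMap.continuous.comp ?_))
    fun_prop⟩
  have hr : ∀ g, (p ((σ (g • x₀))⁻¹ * g)).mat = boostMatrix (r g) := fun g =>
    O12Zero.mat_eq_boostMatrix (hfix g)
  refine ⟨σ, r, fun g => ?_, fun t => ?_⟩
  · refine hp.eq_of_mat_eq (F₁ := fun g => g) (F₂ := fun g => σ (g • x₀) * a (r g))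
      continuous_id (by fun_prop) (fun g => ?_) (x₀ := 1) ?_ g
    · rw [map_mul, O12Zero.mat_mul, ha, ← hr, ← O12Zero.mat_mul, ← map_mul, mul_inv_cancel_left]
    · have : r 1 = 0 := by simp [r, hσ0, O12Zero.mat_one]
      simp [hσ0, this, ha0]
  · have h1 : a t • x₀ = x₀ := hq.boost_smul_eq hlift hx₀ ha0 ha t
    change Real.arsinh ((p ((σ (a t • x₀))⁻¹ * a t)).mat 0 2) = t
    rw [h1, hσ0, inv_one, one_mul, ha]
    simp [boostMatrix]

/-- The boost `a 1` in `G` is a product of contracted commutators: it lies in the subgroup generated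
by two one-parameter groups, which conjugation by `a 1` rescales by the factors `e` and `e⁻¹`. -/
theorem IsUniversalCovering.exists_contracted_generators {G : Type*} [Group G]
    [TopologicalSpace G] [IsTopologicalGroup G] {p : G →* O12Zero} (hp : IsUniversalCovering p)
    {a : C(ℝ, G)} (ha0 : a 0 = 1) (ha : ∀ t, (p (a t)).mat = boostMatrix t) :
    ∃ S : Set G, a 1 ∈ Subgroup.closure S ∧ (∀ u ∈ S, ∃ v ∈ S, u = a 1 * v * (a 1)⁻¹ * v⁻¹) ∧
      ∀ u ∈ S, Tendsto (fun m : ℕ => (a 1 ^ m)⁻¹ * u * a 1 ^ m) atTop (𝓝 1) ∨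
        Tendsto (fun m : ℕ => a 1 ^ m * u * (a 1 ^ m)⁻¹) atTop (𝓝 1) := by
  obtain ⟨U, hU0, hU, hUadd⟩ := hp.exists_lift_add continuous_parabolicMatrix
    parabolicMatrix_orthogonal parabolicMatrix_zero parabolicMatrix_add
  obtain ⟨V, hV0, hV, hVadd⟩ := hp.exists_lift_add continuous_parabolicMatrix'
    parabolicMatrix'_orthogonal parabolicMatrix'_zero parabolicMatrix'_add
  have haU : ∀ s, a 1 * U s * (a 1)⁻¹ = U (Real.exp 1 * s) := fun s => by
    rw [mul_inv_eq_iff_eq_mul]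
    refine hp.eq_of_mat_eq (F₁ := fun s => a 1 * U s) (F₂ := fun s => U (Real.exp 1 * s) * a 1)
      (by fun_prop) (by fun_prop) (fun s => ?_) (x₀ := 0) (by simp [hU0]) s
    simp only [map_mul, O12Zero.mat_mul, ha, hU, boostMatrix_mul_parabolicMatrix]
  have haV : ∀ s, a 1 * V s * (a 1)⁻¹ = V (Real.exp (-1) * s) := fun s => by
    rw [mul_inv_eq_iff_eq_mul]
    refine hp.eq_of_mat_eq (F₁ := fun s => a 1 * V s) (F₂ := fun s => V (Real.exp (-1) * s) * a 1)
      (by fun_prop) (by fun_prop) (fun s => ?_) (x₀ := 0) (by simp [hV0]) s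
    simp only [map_mul, O12Zero.mat_mul, ha, hV, boostMatrix_mul_parabolicMatrix']
  have haU' : ∀ s, (a 1)⁻¹ * U s * ((a 1)⁻¹)⁻¹ = U (Real.exp (-1) * s) := fun s => by
    have := haU (Real.exp (-1) * s)
    rw [← mul_assoc, ← Real.exp_add, add_neg_cancel, Real.exp_zero, one_mul] at this
    rw [← this]
    group
  have hlt : |Real.exp (-1)| < 1 := by
    rw [abs_of_pos (Real.exp_pos _)]
    exact Real.exp_zero ▸ Real.exp_lt_exp.2 (by norm_num)
  refine ⟨Set.range U ∪ Set.range V, ?_, ?_, ?_⟩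
  · have hprod : a 1 = U (-(Real.exp (1 / 2) * (Real.exp (1 / 2) - 1))) *
        V (-Real.exp (-(1 / 2))) * U (Real.exp (1 / 2) - 1) * V 1 := by
      refine hp.eq_of_mat_eq (F₁ := a)
        (F₂ := fun t => U (-(Real.exp (t / 2) * (Real.exp (t / 2) - 1))) *
          V (-Real.exp (-(t / 2))) * U (Real.exp (t / 2) - 1) * V 1)
        a.continuous (by fun_prop) (fun t => ?_) (x₀ := 0) ?_ 1
      · simp only [map_mul, O12Zero.mat_mul, ha, hU, hV, ← boostMatrix_eq_mul]
      · simp [ha0, hU0, ← hVadd, hV0]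
    have hmemU : ∀ s, U s ∈ Subgroup.closure (Set.range U ∪ Set.range V) := fun s =>
      Subgroup.subset_closure (Or.inl ⟨s, rfl⟩)
    have hmemV : ∀ s, V s ∈ Subgroup.closure (Set.range U ∪ Set.range V) := fun s =>
      Subgroup.subset_closure (Or.inr ⟨s, rfl⟩)
    rw [hprod]
    exact mul_mem (mul_mem (mul_mem (hmemU _) (hmemV _)) (hmemU _)) (hmemV _)
  · rintro _ (⟨s, rfl⟩ | ⟨s, rfl⟩)
    · obtain ⟨t, ht⟩ := exists_eq_commutator_of_rescale hUadd
        (Real.exp_one_gt_d9.trans' (by norm_num)).ne' haU s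
      exact ⟨U t, Or.inl ⟨t, rfl⟩, ht⟩
    · obtain ⟨t, ht⟩ := exists_eq_commutator_of_rescale hVadd
        ((le_abs_self _).trans_lt hlt).ne haV s
      exact ⟨V t, Or.inr ⟨t, rfl⟩, ht⟩
  · rintro _ (⟨s, rfl⟩ | ⟨s, rfl⟩)
    · left
      simpa using tendsto_conj_pow_of_rescale hU0 hlt haU' s
    · right
      exact tendsto_conj_pow_of_rescale hV0 hlt haV s

end Main

theorem mainTheorem5
    -- `G` is a universal covering group of `O⁰(1,2)`
    {G : Type*} [Group G] [TopologicalSpace G] [IsTopologicalGroup G]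
    (p : G →* O12Zero) (hp : IsUniversalCovering p)
    -- `D` is a universal covering space of `dS²`
    {D : Type*} [TopologicalSpace D] (q : D → DeSitter2) (hq : IsUniversalCovering q)
    -- the action of `G` on `D` is the lift of the action of `O⁰(1,2)` on `dS²`
    [MulAction G D] [ContinuousSMul G D]
    (hlift : ∀ (g : G) (x : D), q (g • x) = p g • q x)
    -- `H` is a connected (real, finite-dimensional) Lie group
    {E : Type*} [NormedAddCommGroup E] [NormedSpace ℝ E] [FiniteDimensional ℝ E]
    {H : Type*} [Group H] [TopologicalSpace H] [ChartedSpace E H] [LieGroup 𝓘(ℝ, E) ∞ H]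
    [ConnectedSpace H] :
    ¬ ∃ Γ : Subgroup (G × H),
      ActsProperlyDiscontinuously Γ (D × H) ∧ ActsCocompactly Γ (D × H) := by
  rintro ⟨Γ, hpd, hcc⟩
  have := hp.simplyConnected
  have := hq.simplyConnected
  have : IsTopologicalGroup H := topologicalGroup_of_lieGroup 𝓘(ℝ, E) ∞
  have : ProperSpace E := FiniteDimensional.proper_real E
  have : LocallyCompactSpace H := ChartedSpace.locallyCompactSpace E H
  have : T1Space H := ChartedSpace.t1Space E H
  have : T2Space G := hp.isCoveringMap.t2Space
  let csG : ChartedSpace O12Zero G := hp.isCoveringMap.isLocalHomeomorph.toChartedSpace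
  have : LocallyCompactSpace G := ChartedSpace.locallyCompactSpace O12Zero G
  let csD : ChartedSpace DeSitter2 D := hq.isCoveringMap.isLocalHomeomorph.toChartedSpace
  have : LocallyCompactSpace D := ChartedSpace.locallyCompactSpace DeSitter2 D
  obtain ⟨x₀, hx₀⟩ := hq.surjective deSitterBase
  obtain ⟨a, ha0, ha, haadd⟩ := hp.exists_lift_add continuous_boostMatrix
    boostMatrix_orthogonal boostMatrix_zero boostMatrix_add
  have hax₀ := hq.boost_smul_eq hlift hx₀ ha0 ha
  obtain ⟨σ, r, hσr, hra⟩ := hp.exists_decomposition hq hlift hx₀ ha0 ha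
  obtain ⟨S, haS, hScomm, hScontr⟩ := hp.exists_contracted_generators ha0 ha
  have hapow : ∀ n : ℤ, a 1 ^ n = a n := fun n => by
    induction n with
    | zero => simp [ha0]
    | succ n ih => rw [zpow_add_one, ih, ← haadd]; push_cast; rfl
    | pred n ih =>
      rw [zpow_sub_one, ih, mul_inv_eq_iff_eq_mul, ← haadd]; push_cast; congr 1; ring
  have hsmul : ∀ (γ : Γ) (y : D × H), γ • y = (γ.val.1 • y.1, γ.val.2 * y.2) := fun _ _ => rfl
  have : ContinuousConstSMul Γ (D × H) := ⟨fun γ => by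
    simp only [hsmul]; fun_prop⟩
  -- the orbit map of `(x₀, 1)`, with respect to which `Γ × ℤ` acts on `G × H` over `Γ` on `D × H`
  let π : G × H → D × H := fun x => (x.1 • x₀, x.2)
  have hπ : Continuous π := by fun_prop
  have hπact : ∀ (γ : Γ) (n : ℤ) (x : G × H),
      π (γ.val * x * (a 1, 1) ^ n) = γ • π x := fun γ n x => by
    simp [π, hsmul, mul_smul, hapow, hax₀]
  refine not_proper_cocompact_of_contracted_commutators Γ ((a 1, 1) : G × H)
    (MonoidHom.inl G H '' S) ?_ ?_ ?_ (fun C hC => ?_) ?_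
  · rintro _ ⟨u, hu, rfl⟩
    have hinl : Continuous (MonoidHom.inl G H) := by
      change Continuous fun g : G => (g, (1 : H)); fun_prop
    have h1 := hinl.tendsto 1
    rw [map_one] at h1
    exact (hScontr u hu).imp
      (fun h => by simpa [Function.comp_def] using h1.comp h)
      (fun h => by simpa [Function.comp_def] using h1.comp h)
  · rintro _ ⟨u, hu, rfl⟩
    obtain ⟨v, hv, huv⟩ := hScomm u hu
    exact ⟨_, ⟨v, hv, rfl⟩, by rw [huv]; simp⟩
  · rw [← MonoidHom.map_closure]
    exact ⟨a 1, haS, rfl⟩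
  · -- finitely many `γ` by properness on `D × H`; for each of them, finitely many `n`, because
    -- `aⁿ` stays in a compact set, on which `r` is bounded
    have hfin := hpd.finite_disjoint_inter_image (hC.image hπ) (hC.image hπ)
    have hfinn : ∀ γ : Γ, {n : ℤ | ∃ x ∈ C, (γ : G × H) * x * (a 1, 1) ^ n ∈ C}.Finite := by
      intro γ
      let Φ : (G × H) × (G × H) → ℝ := fun z => r ((((γ : G × H) * z.1)⁻¹ * z.2).1)
      have hΦ : Continuous Φ := by fun_prop
      obtain ⟨B, hB⟩ := (hC.prod hC).exists_bound_of_continuousOn hΦ.continuousOn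
      refine (Set.finite_Icc (-⌈B⌉) ⌈B⌉).subset ?_
      rintro n ⟨x, hx, hxn⟩
      have h1 := hB (x, (γ : G × H) * x * (a 1, 1) ^ n) ⟨hx, hxn⟩
      have h2 : Φ (x, (γ : G × H) * x * (a 1, 1) ^ n) = n := by
        simp only [Φ, inv_mul_cancel_left]
        rw [Prod.pow_fst, hapow, hra]
      rw [h2, Real.norm_eq_abs, abs_le] at h1
      have h3 := Int.le_ceil B
      constructor
      · have : ((-⌈B⌉ : ℤ) : ℝ) ≤ n := by push_cast; linarith
        exact_mod_cast this
      · have : (n : ℝ) ≤ (⌈B⌉ : ℤ) := by linarith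
        exact_mod_cast this
    refine (hfin.biUnion fun γ _ => (Set.finite_singleton γ).prod (hfinn γ)).subset ?_
    rintro ⟨γ, n⟩ ⟨x, hx, hxn⟩
    refine Set.mem_iUnion₂.2 ⟨γ, ?_, rfl, x, hx, hxn⟩
    have hne : ((γ • ·) '' (π '' C) ∩ π '' C).Nonempty :=
      ⟨γ • π x, ⟨_, ⟨x, hx, rfl⟩, rfl⟩, _, hxn, hπact γ n x⟩
    exact hne
  · obtain ⟨C, hC, hcov⟩ := exists_compact_meets_orbits hcc
    -- over `C`, the points `σ y * a t` with `0 ≤ t ≤ 1` suffice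
    refine ⟨(fun z : (D × H) × ℝ => (σ z.1.1 * a z.2, z.1.2)) '' (C ×ˢ Set.Icc 0 1),
      (hC.prod isCompact_Icc).image (by fun_prop), fun x => ?_⟩
    obtain ⟨γ, hγ⟩ := hcov (π x)
    set g : G := γ.val.1 * x.1 with hg
    refine ⟨(γ, -⌊r g⌋), (γ • π x, Int.fract (r g)),
      ⟨hγ, Int.fract_nonneg _, (Int.fract_lt_one _).le⟩, ?_⟩
    have h1 : (γ • π x).1 = g • x₀ := by simp [hsmul, π, hg, mul_smul]
    have h2 : σ (g • x₀) * a (Int.fract (r g)) = g * a (-⌊r g⌋) := by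
      have h3 : g * a (-⌊r g⌋) = σ (g • x₀) * a (r g) * a (-⌊r g⌋) := by rw [← hσr g]
      rw [h3, mul_assoc, ← haadd, ← sub_eq_add_neg]; rfl
    refine Prod.ext ?_ ?_
    · simp only [h1, h2, Prod.fst_mul, Prod.pow_fst, hapow]
      push_cast
      rfl
    · simp [hsmul, π]
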